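/- Let $n,m\ge 1$ be integers. Graphs are finite and may have parallel edges but no loops; a perfect matching of a graph is a set of edges such that every vertex is incident with exactly one edge of the set, and $M(G)$ is the number of perfect matchings of $G$ (parallel edges are distinct). Let $G(n,m)$ be the following parallelogram of the Kagomé lattice: its vertices are the points $(x,y)\in\mathbb Z^2$ with $0\le x\le 2n$, $0\le y\le 4m$ and $x,y$ not both even, two of them being adjacent if and only if they differ by $\pm(1,0)$, $\pm(0,1)$ or $\pm(1,-1)$. For $1\le i\le 2m$ and $1\le j\le n$ put $u_i=(0,2i-1)$, $u_i^*=(2n,2i-1)$, $v_j=(2j-1,0)$, $v_j^*=(2j-1,4m)$. The Kagomé lattices with toroidal, cylindrical and free boundary conditions are the following graphs. - $K^T(n,m)$ is obtained from $G(n,m)$ by identifying $u_i$ with $u_i^*$ for all $i$ and $v_j$ with $v_j^*$ for all $j$ (all edges are kept, so parallel edges arise when $n=1$). - $K^C(n,m)$ is obtained from $G(n,m)$ by deleting all $v_j^*$ and then identifying $u_i$ with $u_i^*$ for all $i$ (again keeping the remaining edges). - $K^F(n,m)$ is obtained from $G(n,m)$ by deleting all $u_i^*$ and all $v_j^*$.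 Then for all integers $n,m\ge 1$ $$M(K^T(n,m))=2^{2mn+1},\qquad M(K^C(n,m))=2^{2mn-n+1},\qquad M(K^F(n,m))=2^{2mn-2m-n+1}.$$ Moreover, all three families have entropy $\tfrac23\ln 2$: for $K=K^T,K^C,K^F$, $$\lim_{n,m\to\infty}\frac{2\ln M(K(n,m))}{|V(K(n,m))|}=\tfrac23\ln 2 .$$ -/

import Mathlib

open Filter Topology
open scoped Graph

noncomputable section

namespace KagomeDimers

/-- A perfect matching of a multigraph: a set of edges, none of them a loop, such that every
vertex is incident with exactly one edge of the set. -/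
def IsPerfectMatching {α β : Type*} (G : Graph α β) (M : Set β) : Prop :=
  M ⊆ E(G) ∧ (∀ e ∈ M, ∀ x, ¬ G.IsLoopAt e x) ∧ ∀ x ∈ V(G), ∃! e, e ∈ M ∧ G.Inc e x

/-- The number `M(G)` of perfect matchings. These are sets of edges, so that the choice between
parallel edges is counted. -/
def numPerfectMatchings {α β : Type*} (G : Graph α β) : ℕ :=
  {M : Set β | IsPerfectMatching G M}.ncard

/-- The two-parameter family `G n m` has entropy `h`: `2 log M(G n m) / |V(G n m)|` tends to `h`
as `n` and `m` tend to infinity (independently of each other). -/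
def HasEntropy {α β : Type*} (G : ℕ → ℕ → Graph α β) (h : ℝ) : Prop :=
  Tendsto (fun p : ℕ × ℕ =>
      2 * Real.log (numPerfectMatchings (G p.1 p.2)) / ((V(G p.1 p.2)).ncard : ℝ))
    (atTop ×ˢ atTop) (𝓝 h)

/-- The triangular lattice in lattice coordinates: every point of `ℤ × ℤ` is joined to its six
translates by `±(1, 0)`, `±(0, 1)`, `±(1, -1)`. -/
def triangularLattice : SimpleGraph (ℤ × ℤ) :=
  SimpleGraph.fromRel fun p q => q = p + (1, 0) ∨ q = p + (0, 1) ∨ q = p + (1, -1)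

/-- The sites of the Kagomé lattice (the points of the triangular lattice whose coordinates are
not both even) that lie in the parallelogram `[0, 2n] × [0, 4m]`. -/
def patchSites (n m : ℕ) : Set (ℤ × ℤ) :=
  {p | (Odd p.1 ∨ Odd p.2) ∧ (0 ≤ p.1 ∧ p.1 ≤ 2 * n) ∧ (0 ≤ p.2 ∧ p.2 ≤ 4 * m)}

/-- The plane lattice graph `G(n, m)`, a parallelogram of the Kagomé lattice with `n` hexagonal
cells in one direction and `2m` in the other. Its vertices of degree two are
`u i = (0, 2i - 1)` and `u* i = (2n, 2i - 1)` for `1 ≤ i ≤ 2m` on the left and on the right, and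
`v j = (2j - 1, 0)` and `v* j = (2j - 1, 4m)` for `1 ≤ j ≤ n` at the bottom and at the top; all
its other vertices have degree four. -/
def patch (n m : ℕ) : Graph (ℤ × ℤ) (Sym2 (ℤ × ℤ)) :=
  (Graph.ofSimpleGraph triangularLattice).induce (patchSites n m)

/-- The set of the vertices `u* i`, `1 ≤ i ≤ 2m`. -/
def uStars (n m : ℕ) : Set (ℤ × ℤ) :=
  {p | ∃ i : ℕ, 1 ≤ i ∧ i ≤ 2 * m ∧ p = (2 * (n : ℤ), 2 * (i : ℤ) - 1)}

/-- The set of the vertices `v* j`, `1 ≤ j ≤ n`. -/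
def vStars (n m : ℕ) : Set (ℤ × ℤ) :=
  {p | ∃ j : ℕ, 1 ≤ j ∧ j ≤ n ∧ p = (2 * (j : ℤ) - 1, 4 * (m : ℤ))}

/-- The identification of each `u* i = (2n, 2i - 1)` with `u i = (0, 2i - 1)`; every other vertex
of `patch n m` is fixed. -/
def glueU (n : ℕ) (p : ℤ × ℤ) : ℤ × ℤ := if p.1 = 2 * n then (0, p.2) else p

/-- The identification of each `v* j = (2j - 1, 4m)` with `v j = (2j - 1, 0)`; every other vertex
of `patch n m` is fixed. -/
def glueV (m : ℕ) (p : ℤ × ℤ) : ℤ × ℤ := if p.2 = 4 * m then (p.1, 0) else p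

/-- The Kagomé lattice `K^T(n, m)` with toroidal boundary condition. Edges are kept when vertices
are identified, so parallel edges can arise (they do exactly for `n = 1`). -/
def kagomeTorus (n m : ℕ) : Graph (ℤ × ℤ) (Sym2 (ℤ × ℤ)) :=
  ((patch n m).map (glueU n)).map (glueV m)

/-- The Kagomé lattice `K^C(n, m)` with cylindrical boundary condition: delete the `v* j`, and
identify the `u* i` with the `u i`. -/
def kagomeCylinder (n m : ℕ) : Graph (ℤ × ℤ) (Sym2 (ℤ × ℤ)) :=
  ((patch n m).deleteVerts (vStars n m)).map (glueU n)

/-- The Kagomé lattice `K^F(n, m)` with free boundary condition: delete the `u* i` and the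
`v* j`. -/
def kagomeFree (n m : ℕ) : Graph (ℤ × ℤ) (Sym2 (ℤ × ℤ)) :=
  (patch n m).deleteVerts (uStars n m ∪ vStars n m)

end KagomeDimers

end

/-!
The Kagomé lattice is the line graph of the honeycomb lattice `H` whose vertices are the triangles
and whose edges are the sites. Since `H` has maximum degree three, a perfect matching is the same as
an even orientation of `H`: a matched edge is a side of one triangle, direct its two ends, which are
edges of `H`, towards that triangle; conversely every triangle receives zero or two edges, and the
two are matched across it. The even orientations form an affine space over the field with two
elements that is parallel to the cycle space of `H`, so that there are `2 ^ (|E(H)| - |V(H)| + 1)`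
of them if `H` is connected with an even number of edges. Always `|E(H)| = 6mn`. With toroidal
boundary conditions `|V(H)| = 4mn`, and at each side that is not glued triangles stick out of the
parallelogram, which are additional vertices of degree one.
-/

namespace KagomeDimers

section EvenOrientations

open scoped Classical in
/-- The column of the edge `e` in the incidence matrix of `H` over the field with two elements. -/
noncomputable def incidenceVector {τ α : Type*} (H : Graph τ α) (e : α) : V(H) → ZMod 2 :=
  fun t => if H.Inc e t then 1 else 0

/-- The boundary map of `H` over the field with two elements; its kernel is the cycle space. -/
noncomputable def boundary {τ α : Type*} (H : Graph τ α) [Fintype E(H)] :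
    (E(H) → ZMod 2) →ₗ[ZMod 2] (V(H) → ZMod 2) :=
  Fintype.linearCombination (ZMod 2) fun e : E(H) => incidenceVector H e

/-- Connectedness of a multigraph: some vertex reaches all the others. -/
def IsConnected {τ α : Type*} (H : Graph τ α) : Prop :=
  ∃ r ∈ V(H), ∀ t ∈ V(H), Relation.ReflTransGen H.Adj r t

/-- An even orientation of a multigraph: each edge is directed towards one of its ends, and each
vertex receives an even number of edges. The orientation is encoded as the map sending an edge to
its head, which determines the direction as soon as there are no loops. -/
structure IsEvenOrientation {τ α : Type*} (H : Graph τ α) (o : E(H) → V(H)) : Prop where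
  inc : ∀ e : E(H), H.Inc e (o e)
  even_fiber : ∀ t, Even {e | o e = t}.ncard

variable {τ α : Type*} {H : Graph τ α}

theorem incidenceVector_eq [H.Loopless] [DecidableEq V(H)] {e : α} {s t : V(H)}
    (h : H.IsLink e s t) :
    incidenceVector H e = Pi.single s 1 + Pi.single t 1 := by
  have hst : s ≠ t := by
    rintro rfl
    exact Graph.Loopless.not_isLoopAt (G := H) e s h
  have hInc (r : V(H)) : H.Inc e r ↔ r = s ∨ r = t := by
    refine ⟨fun hr => by simpa only [Subtype.ext_iff] using hr.eq_or_eq_of_isLink h, ?_⟩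
    rintro (rfl | rfl)
    exacts [h.inc_left, h.inc_right]
  ext r
  by_cases hrs : r = s
  · simp [incidenceVector, hInc, hrs, hst]
  · by_cases hrt : r = t <;> simp [incidenceVector, hInc, hrs, hrt, hst.symm]

theorem boundary_single [Fintype E(H)] [DecidableEq E(H)] (e : E(H)) :
    boundary H (Pi.single e 1) = incidenceVector H e := by
  simp [boundary, Fintype.linearCombination_apply_single]

theorem range_boundary [H.Loopless] [Fintype E(H)] [Fintype V(H)] (hH : IsConnected H) :
    (boundary H).range =
      (Fintype.linearCombination (ZMod 2) fun _ : V(H) => (1 : ZMod 2)).ker := by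
  classical
  apply le_antisymm
  · rw [boundary, Fintype.range_linearCombination, Submodule.span_le]
    rintro _ ⟨⟨e, he⟩, rfl⟩
    obtain ⟨s, t, hst⟩ := Graph.exists_isLink_of_mem_edgeSet he
    simp [incidenceVector_eq (s := ⟨s, hst.left_mem⟩) (t := ⟨t, hst.right_mem⟩) hst,
      CharTwo.add_self_eq_zero]
  obtain ⟨r, hr, hreach⟩ := hH
  have hpair (t : τ) (h : Relation.ReflTransGen H.Adj r t) (ht : t ∈ V(H)) :
      Pi.single ⟨r, hr⟩ 1 + Pi.single ⟨t, ht⟩ 1 ∈ (boundary H).range := by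
    induction h with
    | refl => exact ⟨0, by rw [map_zero, ZModModule.add_self]⟩
    | @tail s t _ hst ih =>
      obtain ⟨e, he⟩ := hst
      have hstep : boundary H (Pi.single ⟨e, he.edge_mem⟩ 1) =
          Pi.single ⟨s, he.left_mem⟩ 1 + Pi.single ⟨t, ht⟩ 1 :=
        (boundary_single _).trans (incidenceVector_eq he)
      have hmem := add_mem (ih he.left_mem) ⟨_, hstep⟩
      rwa [ZModModule.add_add_add_cancel] at hmem
  intro y hy
  have hsum : ∑ t, y t = 0 := by simpa [Fintype.linearCombination_apply] using hy
  have hy' : y = ∑ t, y t • (Pi.single ⟨r, hr⟩ 1 + Pi.single t 1) := by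
    simp only [smul_add, Finset.sum_add_distrib, ← Finset.sum_smul, hsum, zero_smul, zero_add]
    exact pi_eq_sum_univ' y
  rw [hy']
  exact sum_mem fun t _ => Submodule.smul_mem _ _ (hpair t (hreach t t.2) t.2)

theorem finrank_ker_boundary_add_ncard [H.Loopless] [Fintype E(H)] [Finite V(H)]
    (hH : IsConnected H) :
    Module.finrank (ZMod 2) (boundary H).ker + V(H).ncard = E(H).ncard + 1 := by
  classical
  have := Fintype.ofFinite V(H)
  let φ : (V(H) → ZMod 2) →ₗ[ZMod 2] ZMod 2 := Fintype.linearCombination (ZMod 2) fun _ => 1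
  have hφ : φ.range = ⊤ := LinearMap.range_eq_top.2 fun c => by
    obtain ⟨r, hr, -⟩ := hH
    exact ⟨Pi.single ⟨r, hr⟩ c, by simp [φ, Fintype.linearCombination_apply_single]⟩
  have hV := φ.finrank_range_add_finrank_ker
  have hE := (boundary H).finrank_range_add_finrank_ker
  rw [hφ, finrank_top, Module.finrank_self, Module.finrank_pi] at hV
  rw [range_boundary hH, Module.finrank_pi] at hE
  rw [← Nat.card_coe_set_eq, ← Nat.card_coe_set_eq, Nat.card_eq_fintype_card,
    Nat.card_eq_fintype_card]
  change _ + Module.finrank (ZMod 2) φ.ker = _ at hV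
  change Module.finrank (ZMod 2) φ.ker + _ = _ at hE
  lia

theorem ncard_preimage_singleton {R M N : Type*} [Ring R] [AddCommGroup M] [AddCommGroup N]
    [Module R M] [Module R N] (f : M →ₗ[R] N) {y : N} (hy : y ∈ f.range) :
    (f ⁻¹' {y}).ncard = Nat.card f.ker := by
  obtain ⟨x, rfl⟩ := hy
  have : f ⁻¹' {f x} = (x + ·) '' f.ker := by
    ext z
    simp [neg_add_eq_sub, sub_eq_zero]
  rw [this, Set.ncard_image_of_injective _ (add_right_injective x)]
  rfl

theorem even_fiber_iff_sum_single_eq_zero {ι T : Type*} [Fintype ι] [DecidableEq T] (o : ι → T) :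
    (∀ t, Even {e | o e = t}.ncard) ↔ ∑ e, (Pi.single (o e) 1 : T → ZMod 2) = 0 := by
  simp only [funext_iff, Finset.sum_apply, Pi.zero_apply, Pi.single_apply, Finset.sum_boole,
    ZMod.natCast_eq_zero_iff_even, Set.ncard_eq_toFinset_card', Set.toFinset_ofPred,
    eq_comm (b := o _)]

/-- The assignment of heads encoded by a vector over the field with two elements, for a graph whose
edge `e` joins `a e` and `b e`: the head is `a e` if `x e = 0` and `b e` if `x e = 1`. -/
def headOf {ι T : Type*} (a b : ι → T) (x : ι → ZMod 2) : ι → T :=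
  fun e => if x e = 0 then a e else b e

theorem headOf_injective {ι T : Type*} {a b : ι → T} (hab : ∀ e, a e ≠ b e) :
    Function.Injective (headOf a b) := by
  intro x y hxy
  ext e
  have he := congrFun hxy e
  by_cases hx : x e = 0 <;> by_cases hy : y e = 0
  · rw [hx, hy]
  · simp [headOf, hx, hy, hab e] at he
  · simp [headOf, hx, hy, (hab e).symm] at he
  · rw [Fin.eq_one_of_ne_zero (x e) hx, Fin.eq_one_of_ne_zero (y e) hy]

theorem mem_range_headOf_iff {a b o : E(H) → V(H)} (hab : ∀ e : E(H), H.IsLink e (a e) (b e)) :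
    o ∈ Set.range (headOf a b) ↔ ∀ e : E(H), H.Inc e (o e) := by
  classical
  constructor
  · rintro ⟨x, rfl⟩ e
    by_cases hx : x e = 0
    · simpa [headOf, hx] using (hab e).inc_left
    · simpa [headOf, hx] using (hab e).inc_right
  · refine fun ho => ⟨fun e => if o e = a e then 0 else 1, funext fun e => ?_⟩
    by_cases he : o e = a e
    · simp [headOf, he]
    · have := (ho e).eq_or_eq_of_isLink (hab e)
      simp_all [headOf, Subtype.ext_iff]

theorem sum_single_headOf [H.Loopless] [Fintype E(H)] [DecidableEq V(H)] {a b : E(H) → V(H)}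
    (hab : ∀ e : E(H), H.IsLink e (a e) (b e)) (x : E(H) → ZMod 2) :
    ∑ e, (Pi.single (headOf a b x e) 1 : V(H) → ZMod 2) =
      ∑ e, Pi.single (a e) 1 + boundary H x := by
  rw [boundary, Fintype.linearCombination_apply, ← Finset.sum_add_distrib]
  refine Finset.sum_congr rfl fun e _ => ?_
  rw [incidenceVector_eq (hab e)]
  by_cases hx : x e = 0
  · simp [headOf, hx]
  · have hx1 : x e = 1 := Fin.eq_one_of_ne_zero (x e) hx
    simp [headOf, hx1, ← add_assoc, ZModModule.add_self]

theorem isEvenOrientation_headOf_iff [H.Loopless] [Fintype E(H)] [DecidableEq V(H)]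
    {a b : E(H) → V(H)} (hab : ∀ e : E(H), H.IsLink e (a e) (b e)) (x : E(H) → ZMod 2) :
    IsEvenOrientation H (headOf a b x) ↔ boundary H x = ∑ e, Pi.single (a e) 1 := by
  have hsum : ∑ e, (Pi.single (headOf a b x e) 1 : V(H) → ZMod 2) = 0 ↔
      boundary H x = ∑ e, Pi.single (a e) 1 := by
    rw [sum_single_headOf hab, ← ZModModule.sub_eq_add, sub_eq_zero, eq_comm]
  rw [← hsum, ← even_fiber_iff_sum_single_eq_zero]
  exact ⟨IsEvenOrientation.even_fiber, .mk ((mem_range_headOf_iff hab).1 ⟨x, rfl⟩)⟩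

theorem ncard_isEvenOrientation_mul [H.Loopless] (hE : E(H).Finite) (hV : V(H).Finite)
    (hH : IsConnected H) (heven : Even E(H).ncard) :
    {o | IsEvenOrientation H o}.ncard * 2 ^ V(H).ncard = 2 ^ (E(H).ncard + 1) := by
  classical
  have := hE.fintype
  have := hV.fintype
  have hends (e : E(H)) : ∃ a b : V(H), H.IsLink e a b := by
    obtain ⟨a, b, h⟩ := Graph.exists_isLink_of_mem_edgeSet e.2
    exact ⟨⟨a, h.left_mem⟩, ⟨b, h.right_mem⟩, h⟩
  choose a b hab using hends
  have hne (e : E(H)) : a e ≠ b e := fun h =>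
    Graph.Loopless.not_isLoopAt (G := H) e (b e) (h ▸ hab e)
  have hrange : ∑ e, Pi.single (a e) 1 ∈ (boundary H).range := by
    rw [← Nat.card_coe_set_eq, Nat.card_eq_fintype_card] at heven
    simpa [range_boundary hH, ZMod.natCast_eq_zero_iff_even] using heven
  have himage : {o | IsEvenOrientation H o} =
      headOf a b '' (boundary H ⁻¹' {∑ e, Pi.single (a e) 1}) := by
    ext o
    constructor
    · intro ho
      obtain ⟨x, rfl⟩ := (mem_range_headOf_iff hab).2 ho.inc
      exact ⟨x, (isEvenOrientation_headOf_iff hab x).1 ho, rfl⟩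
    · rintro ⟨x, hx, rfl⟩
      exact (isEvenOrientation_headOf_iff hab x).2 hx
  have hcard : {o | IsEvenOrientation H o}.ncard =
      2 ^ Module.finrank (ZMod 2) (boundary H).ker := by
    rw [himage, Set.ncard_image_of_injective _ (headOf_injective hne),
      ncard_preimage_singleton _ hrange, Module.natCard_eq_pow_finrank (K := ZMod 2),
      Nat.card_zmod]
  rw [hcard, ← pow_add, finrank_ker_boundary_add_ncard hH]

end EvenOrientations

section LineGraphs

/-- `G` is the line graph of `H`: its vertices are the edges of `H`, and for each common end `t` of
two different edges of `H` there is exactly one edge of `G` that joins them across `t`. Here `c f`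
is the vertex of `H` across which the edge `f` of `G` joins its ends. -/
structure IsLineGraphOf {τ α β : Type*} (G : Graph α β) (H : Graph τ α) (c : β → τ) : Prop where
  vertexSet_eq : V(G) = E(H)
  ne_of_isLink {f x y} : G.IsLink f x y → x ≠ y
  inc_of_inc {f x} : G.Inc f x → H.Inc x (c f)
  existsUnique_isLink {x y t} : H.Inc x t → H.Inc y t → x ≠ y → ∃! f, G.IsLink f x y ∧ c f = t

/-- The edges of the line graph that pair the edges of `H` with the same head. -/
def pairingOf {τ α β : Type*} (G : Graph α β) (H : Graph τ α) (c : β → τ) (o : E(H) → V(H)) :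
    Set β :=
  {f | f ∈ E(G) ∧ ∀ x : E(H), G.Inc f x → (o x : τ) = c f}

variable {τ α β : Type*} {G : Graph α β} {H : Graph τ α} {c : β → τ} {o : E(H) → V(H)}

theorem even_ncard_of_involution {ι : Type*} {s : Set ι} (hs : s.Finite) (g : ι → ι)
    (hmaps : Set.MapsTo g s s) (hne : ∀ i ∈ s, g i ≠ i) (hinv : ∀ i ∈ s, g (g i) = i) :
    Even s.ncard := by
  rw [Set.ncard_eq_toFinset_card s hs, ← ZMod.natCast_eq_zero_iff_even, Finset.cast_card]
  refine Finset.sum_involution (fun i _ => g i) (fun _ _ => ZModModule.add_self _) ?_ ?_ ?_ <;>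
    simp_all [Set.MapsTo]

namespace IsEvenOrientation

theorem ncard_fiber_eq_two (ho : IsEvenOrientation H o) (hE : E(H).Finite) (x : E(H))
    (hdeg : (H.incidenceSet (o x : τ)).ncard ≤ 3) : {y | o y = o x}.ncard = 2 := by
  have hsub : Subtype.val '' {y | o y = o x} ⊆ H.incidenceSet (o x : τ) := by
    rintro _ ⟨y, hy, rfl⟩
    exact hy ▸ ho.inc y
  have hle := Set.ncard_le_ncard hsub (hE.subset (H.incidenceSet_subset_edgeSet _))
  rw [Set.ncard_image_of_injective _ Subtype.val_injective] at hle
  have hpos : 0 < {y | o y = o x}.ncard :=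
    have := hE.to_subtype
    (Set.ncard_pos).2 ⟨x, rfl⟩
  obtain ⟨k, hk⟩ := ho.even_fiber (o x)
  lia

theorem existsUnique_partner (ho : IsEvenOrientation H o) (hE : E(H).Finite) (x : E(H))
    (hdeg : (H.incidenceSet (o x : τ)).ncard ≤ 3) : ∃! y, y ≠ x ∧ o y = o x := by
  obtain ⟨a, b, hab, hfiber⟩ := Set.ncard_eq_two.1 (ho.ncard_fiber_eq_two hE x hdeg)
  have hmem (y : E(H)) : o y = o x ↔ y = a ∨ y = b := Set.ext_iff.1 hfiber y
  obtain rfl | rfl := (hmem x).1 rfl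
  · exact ⟨b, ⟨hab.symm, (hmem b).2 (.inr rfl)⟩, fun y hy => ((hmem y).1 hy.2).resolve_left hy.1⟩
  · exact ⟨a, ⟨hab, (hmem a).2 (.inl rfl)⟩, fun y hy => ((hmem y).1 hy.2).resolve_right hy.1⟩

end IsEvenOrientation

theorem IsPerfectMatching.eq_of_subset {M M' : Set β} (hM : IsPerfectMatching G M)
    (hM' : IsPerfectMatching G M') (h : M ⊆ M') : M = M' := by
  refine h.antisymm fun f hf => ?_
  obtain ⟨x, y, hxy⟩ := Graph.exists_isLink_of_mem_edgeSet (hM'.1 hf)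
  obtain ⟨f', ⟨hf', hx⟩, -⟩ := hM.2.2 x hxy.left_mem
  exact (hM'.2.2 x hxy.left_mem).unique ⟨h hf', hx⟩ ⟨hf, hxy.inc_left⟩ ▸ hf'

namespace IsLineGraphOf

theorem mem_vertexSet (hG : IsLineGraphOf G H c) (x : E(H)) : (x : α) ∈ V(G) := by
  rw [hG.vertexSet_eq]
  exact x.2

theorem isPerfectMatching_pairingOf (hG : IsLineGraphOf G H c) (hE : E(H).Finite)
    (hdeg : ∀ t, (H.incidenceSet t).ncard ≤ 3) (ho : IsEvenOrientation H o) :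
    IsPerfectMatching G (pairingOf G H c o) := by
  refine ⟨fun f hf => hf.1, fun f _ x hx => hG.ne_of_isLink hx rfl, fun x hx => ?_⟩
  lift x to E(H) using hG.vertexSet_eq ▸ hx
  obtain ⟨y, ⟨hyx, hoy⟩, hy⟩ := ho.existsUnique_partner hE x (hdeg _)
  obtain ⟨f, ⟨hlink, hcf⟩, hf⟩ := hG.existsUnique_isLink (ho.inc x) (hoy ▸ ho.inc y)
    (Subtype.coe_ne_coe.2 hyx.symm)
  refine ⟨f, ⟨⟨hlink.edge_mem, fun z hz => ?_⟩, hlink.inc_left⟩, ?_⟩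
  · obtain hz | hz := hz.eq_or_eq_of_isLink hlink
    · rw [Subtype.ext hz, hcf]
    · rw [Subtype.ext hz, hoy, hcf]
  · rintro f' ⟨⟨-, hf'⟩, hinc⟩
    obtain ⟨z, hz⟩ := hinc
    lift z to E(H) using (hG.inc_of_inc hz.inc_right).edge_mem
    obtain rfl : z = y := hy z ⟨Subtype.coe_ne_coe.1 (hG.ne_of_isLink hz).symm,
      Subtype.ext ((hf' z hz.inc_right).trans (hf' x hz.inc_left).symm)⟩
    exact hf f' ⟨hz, (hf' x hz.inc_left).symm⟩

theorem injOn_pairingOf (hG : IsLineGraphOf G H c) (hE : E(H).Finite)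
    (hdeg : ∀ t, (H.incidenceSet t).ncard ≤ 3) :
    Set.InjOn (pairingOf G H c) {o | IsEvenOrientation H o} := by
  intro o ho o' _ hoo'
  ext x
  obtain ⟨f, ⟨hf, hfx⟩, -⟩ :=
    (hG.isPerfectMatching_pairingOf hE hdeg ho).2.2 x (hG.mem_vertexSet x)
  have hf' : f ∈ pairingOf G H c o' := hoo' ▸ hf
  exact (hf.2 x hfx).trans (hf'.2 x hfx).symm

theorem even_ncard_fiber (hG : IsLineGraphOf G H c) (hE : E(H).Finite) {M : Set β}
    (hM : IsPerfectMatching G M) (ho : ∀ f ∈ M, ∀ x : E(H), G.Inc f x → (o x : τ) = c f)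
    (t : V(H)) : Even {x | o x = t}.ncard := by
  have hmatched (x : E(H)) : ∃ y : E(H), ∃ f ∈ M, G.IsLink f x y := by
    obtain ⟨f, ⟨hf, y, hy⟩, -⟩ := hM.2.2 x (hG.mem_vertexSet x)
    exact ⟨⟨y, (hG.inc_of_inc hy.inc_right).edge_mem⟩, f, hf, hy⟩
  choose g f hf hlink using hmatched
  have hpartner (x : E(H)) : o (g x) = o x := Subtype.ext
    ((ho _ (hf x) _ (hlink x).inc_right).trans (ho _ (hf x) _ (hlink x).inc_left).symm)
  have := hE.to_subtype
  refine even_ncard_of_involution (Set.toFinite _) g (fun x hx => (hpartner x).trans hx)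
    (fun x _ => Subtype.coe_ne_coe.1 (hG.ne_of_isLink (hlink x)).symm) fun x _ => ?_
  have hfg : f (g x) = f x := (hM.2.2 (g x) (hlink x).right_mem).unique
    ⟨hf _, (hlink _).inc_left⟩ ⟨hf x, (hlink x).inc_right⟩
  exact Subtype.ext ((hfg ▸ hlink (g x)).right_unique (hlink x).symm)

theorem exists_pairingOf_eq (hG : IsLineGraphOf G H c) (hE : E(H).Finite)
    (hdeg : ∀ t, (H.incidenceSet t).ncard ≤ 3) {M : Set β} (hM : IsPerfectMatching G M) :
    ∃ o, IsEvenOrientation H o ∧ pairingOf G H c o = M := by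
  have hcover (x : E(H)) : ∃ f ∈ M, G.Inc f x :=
    let ⟨f, hf, _⟩ := hM.2.2 x (hG.mem_vertexSet x)
    ⟨f, hf⟩
  choose f hf hinc using hcover
  let o (x : E(H)) : V(H) := ⟨c (f x), (hG.inc_of_inc (hinc x)).vertex_mem⟩
  have hoM (f' : β) (hf' : f' ∈ M) (x : E(H)) (hx : G.Inc f' x) : (o x : τ) = c f' :=
    congrArg c ((hM.2.2 x hx.vertex_mem).unique ⟨hf x, hinc x⟩ ⟨hf', hx⟩)
  have ho : IsEvenOrientation H o :=
    ⟨fun x => hG.inc_of_inc (hinc x), hG.even_ncard_fiber hE hM hoM⟩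
  have hsub : M ⊆ pairingOf G H c o := fun f' hf' => ⟨hM.1 hf', hoM f' hf'⟩
  exact ⟨o, ho, (hM.eq_of_subset (hG.isPerfectMatching_pairingOf hE hdeg ho) hsub).symm⟩

theorem numPerfectMatchings_eq (hG : IsLineGraphOf G H c) (hE : E(H).Finite)
    (hdeg : ∀ t, (H.incidenceSet t).ncard ≤ 3) :
    numPerfectMatchings G = {o | IsEvenOrientation H o}.ncard := by
  rw [numPerfectMatchings, ← (hG.injOn_pairingOf hE hdeg).ncard_image]
  congr 1
  ext M
  constructor
  · exact fun hM => hG.exists_pairingOf_eq hE hdeg hM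
  · rintro ⟨o, ho, rfl⟩
    exact hG.isPerfectMatching_pairingOf hE hdeg ho

theorem numPerfectMatchings_mul_two_pow (hG : IsLineGraphOf G H c) [H.Loopless] (hE : E(H).Finite)
    (hV : V(H).Finite) (hdeg : ∀ t, (H.incidenceSet t).ncard ≤ 3) (hH : IsConnected H)
    (heven : Even E(H).ncard) :
    numPerfectMatchings G * 2 ^ V(H).ncard = 2 ^ (E(H).ncard + 1) := by
  rw [hG.numPerfectMatchings_eq hE hdeg, ncard_isEvenOrientation_mul hE hV hH heven]

end IsLineGraphOf

end LineGraphs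

section Honeycomb

/-- The sites of the Kagomé lattice in the half-open parallelogram `[0, 2n) × [0, 4m)`. They
represent the vertices of the Kagomé lattice for all boundary conditions. -/
def sites (n m : ℕ) : Set (ℤ × ℤ) :=
  {p | (Odd p.1 ∨ Odd p.2) ∧ (0 ≤ p.1 ∧ p.1 < 2 * n) ∧ (0 ≤ p.2 ∧ p.2 < 4 * m)}

/-- The coordinate modulo `N` of a triangle if the boundary condition `glued` identifies the two
ends of the coordinate axis. Otherwise the coordinate `-1` stands for a triangle that sticks out of
the parallelogram and is kept apart. -/
def wrap (glued : Bool) (N : ℕ) (z : ℤ) : ℤ := if glued ∧ z = -1 then N - 1 else z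

/-- The triangle of the Kagomé lattice on one side of the site `p`: the one that points up for
`s = 0`, with corners `(2i, 2j + 1)`, `(2i + 1, 2j)`, `(2i + 1, 2j + 1)`, and the one that points
down for `s = 1`, with corners `(2i + 1, 2j + 1)`, `(2i + 2, 2j + 1)`, `(2i + 1, 2j + 2)`. It is
encoded as `(s, i, j)`. The flags `u` and `v` tell whether the sides `u*` and `v*` of the
parallelogram are glued to the sides `u` and `v`. -/
def triangle (u v : Bool) (n m : ℕ) (s : ℤ) (p : ℤ × ℤ) : ℤ × ℤ × ℤ :=
  (s, wrap u n ((p.1 - s) / 2), wrap v (2 * m) ((p.2 - s) / 2))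

/-- The honeycomb lattice dual to the Kagomé lattice: its vertices are the triangles, its edges the
sites, and a site joins the two triangles of which it is a corner. At a side that is not glued the
triangles which stick out of the parallelogram have degree one. -/
def honeycomb (u v : Bool) (n m : ℕ) : Graph (ℤ × ℤ × ℤ) (ℤ × ℤ) where
  vertexSet := {t | ∃ p ∈ sites n m, t = triangle u v n m 0 p ∨ t = triangle u v n m 1 p}
  edgeSet := sites n m
  IsLink p t t' := p ∈ sites n m ∧ s(t, t') = s(triangle u v n m 0 p, triangle u v n m 1 p)
  isLink_symm p _ := ⟨fun t t' h => ⟨h.1, Sym2.eq_swap.trans h.2⟩⟩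
  eq_or_eq_of_isLink_of_isLink := by
    rintro p t t' r r' ⟨-, h⟩ ⟨-, h'⟩
    simp only [Sym2.eq_iff] at h h'
    grind
  edge_mem_iff_exists_isLink p := ⟨fun h => ⟨_, _, h, rfl⟩, fun ⟨_, _, h⟩ => h.1⟩
  left_mem_of_isLink := by
    rintro p t t' ⟨hp, h⟩
    simp only [Sym2.eq_iff] at h
    exact ⟨p, hp, h.imp And.left And.left⟩

variable {u v : Bool} {n m : ℕ}

theorem mem_sites_iff {p : ℤ × ℤ} : p ∈ sites n m ↔
    (p.1 % 2 = 1 ∨ p.2 % 2 = 1) ∧ (0 ≤ p.1 ∧ p.1 < 2 * n) ∧ (0 ≤ p.2 ∧ p.2 < 4 * m) := by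
  rw [← Int.odd_iff, ← Int.odd_iff]
  rfl

theorem honeycomb_inc_iff {p : ℤ × ℤ} {t : ℤ × ℤ × ℤ} : (honeycomb u v n m).Inc p t ↔
    p ∈ sites n m ∧ (t = triangle u v n m 0 p ∨ t = triangle u v n m 1 p) := by
  constructor
  · rintro ⟨t', hp, h⟩
    simp only [Sym2.eq_iff] at h
    exact ⟨hp, h.imp And.left And.left⟩
  · rintro ⟨hp, rfl | rfl⟩
    exacts [⟨_, hp, rfl⟩, ⟨_, hp, Sym2.eq_swap⟩]

theorem honeycomb_inc_iff_fst {p : ℤ × ℤ} {t : ℤ × ℤ × ℤ} : (honeycomb u v n m).Inc p t ↔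
    p ∈ sites n m ∧ (t.1 = 0 ∨ t.1 = 1) ∧ t = triangle u v n m t.1 p := by
  rw [honeycomb_inc_iff]
  grind [triangle]

instance : (honeycomb u v n m).Loopless where
  not_isLoopAt p t h := by
    have := h.2
    simp only [Sym2.eq_iff, triangle] at this
    grind

theorem eq_of_wrap_eq {glued : Bool} {N : ℕ} {s x y : ℤ}
    (hx : 0 ≤ x ∧ x < 2 * N) (hy : 0 ≤ y ∧ y < 2 * N) (hxy : x % 2 = y % 2)
    (h : wrap glued N ((x - s) / 2) = wrap glued N ((y - s) / 2)) : x = y := by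
  unfold wrap at h
  split_ifs at h <;> lia

theorem ncard_incidenceSet_honeycomb_le (t : ℤ × ℤ × ℤ) :
    ((honeycomb u v n m).incidenceSet t).ncard ≤ 3 := by
  let parity (p : ℤ × ℤ) : ℤ × ℤ := (p.1 % 2, p.2 % 2)
  have hmaps : Set.MapsTo parity ((honeycomb u v n m).incidenceSet t)
      ({(0, 1), (1, 0), (1, 1)} : Finset (ℤ × ℤ)) := by
    intro p hp
    have hp := mem_sites_iff.1 (honeycomb_inc_iff.1 hp).1
    simp only [parity, Finset.coe_insert, Finset.coe_singleton, Set.mem_insert_iff,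
      Set.mem_singleton_iff, Prod.mk.injEq]
    lia
  have hinj : Set.InjOn parity ((honeycomb u v n m).incidenceSet t) := by
    intro p hp q hq hpq
    obtain ⟨hp, -, htp⟩ := honeycomb_inc_iff_fst.1 hp
    obtain ⟨hq, -, htq⟩ := honeycomb_inc_iff_fst.1 hq
    rw [mem_sites_iff] at hp hq
    have heq := htp.symm.trans htq
    simp only [triangle, Prod.mk.injEq, true_and] at heq
    simp only [parity, Prod.mk.injEq] at hpq
    ext
    · exact eq_of_wrap_eq hp.2.1 hq.2.1 hpq.1 heq.1
    · exact eq_of_wrap_eq (by grind) (by grind) hpq.2 heq.2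
  simpa using Set.ncard_le_ncard_of_injOn parity hmaps hinj

theorem honeycomb_adj {p : ℤ × ℤ} (hp : p ∈ sites n m) :
    (honeycomb u v n m).Adj (triangle u v n m 0 p) (triangle u v n m 1 p) :=
  ⟨p, hp, rfl⟩

/-- Two upward triangles next to each other have a common neighbour pointing down. -/
theorem honeycomb_reflTransGen_step {i j i' j' : ℤ} (hi : 0 ≤ i) (hj : 0 ≤ j) (hin : i' < n)
    (hjm : j' < 2 * m) (h : (i' = i + 1 ∧ j' = j) ∨ (i' = i ∧ j' = j + 1)) :
    Relation.ReflTransGen (honeycomb u v n m).Adj (0, i, j) (0, i', j') := by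
  have hdown : (honeycomb u v n m).Adj (0, i, j) (1, i, j) := by
    have hp : (2 * i + 1, 2 * j + 1) ∈ sites n m := by rw [mem_sites_iff]; lia
    convert honeycomb_adj (u := u) (v := v) hp using 1 <;> grind [triangle, wrap]
  have hup : (honeycomb u v n m).Adj (0, i', j') (1, i, j) := by
    have hp : (i + i' + 1, j + j' + 1) ∈ sites n m := by rw [mem_sites_iff]; lia
    convert honeycomb_adj (u := u) (v := v) hp using 1 <;> grind [triangle, wrap]
  exact (Relation.ReflTransGen.single hdown).tail hup.symm

theorem honeycomb_reflTransGen_up {i j : ℕ} (hi : i < n) (hj : j < 2 * m) :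
    Relation.ReflTransGen (honeycomb u v n m).Adj (0, 0, 0) (0, (i : ℤ), (j : ℤ)) := by
  have hrow : Relation.ReflTransGen (honeycomb u v n m).Adj (0, 0, 0) (0, (i : ℤ), 0) := by
    induction i with
    | zero => rfl
    | succ i ih => exact (ih (by lia)).trans (honeycomb_reflTransGen_step
        (by lia) le_rfl (by lia) (by lia) (.inl ⟨by push_cast; rfl, rfl⟩))
  induction j with
  | zero => exact hrow
  | succ j ih => exact (ih (by lia)).trans (honeycomb_reflTransGen_step
      (by lia) (by lia) (by lia) (by lia) (.inr ⟨rfl, by push_cast; rfl⟩))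

theorem isConnected_honeycomb (hn : 1 ≤ n) (hm : 1 ≤ m) : IsConnected (honeycomb u v n m) := by
  have hup (p : ℤ × ℤ) (hp : p ∈ sites n m) :
      Relation.ReflTransGen (honeycomb u v n m).Adj (0, 0, 0) (triangle u v n m 0 p) := by
    have hp := mem_sites_iff.1 hp
    convert honeycomb_reflTransGen_up (u := u) (v := v) (n := n) (m := m) (i := (p.1 / 2).toNat)
      (j := (p.2 / 2).toNat) (by lia) (by lia) using 1
    grind [triangle, wrap]
  refine ⟨(0, 0, 0), ⟨(1, 1), mem_sites_iff.2 (by lia), .inl (by grind [triangle, wrap])⟩, ?_⟩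
  rintro _ ⟨p, hp, rfl | rfl⟩
  exacts [hup p hp, (hup p hp).tail (honeycomb_adj hp)]

theorem ncard_sites (n m : ℕ) : (sites n m).ncard = 6 * (m * n) := by
  let box : Finset (ℤ × ℤ) := Finset.Ico 0 ((2 * n : ℕ) : ℤ) ×ˢ Finset.Ico 0 ((4 * m : ℕ) : ℤ)
  let centres : Finset (ℤ × ℤ) :=
    (Finset.Ico 0 (n : ℤ) ×ˢ Finset.Ico 0 ((2 * m : ℕ) : ℤ)).image fun q => (2 * q.1, 2 * q.2)
  have hcentres {p : ℤ × ℤ} : p ∈ centres ↔ p ∈ box ∧ p.1 % 2 = 0 ∧ p.2 % 2 = 0 := by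
    simp only [centres, box, Finset.mem_image, Finset.mem_product, Finset.mem_Ico]
    constructor
    · grind
    · exact fun hp => ⟨(p.1 / 2, p.2 / 2), by lia, by grind⟩
  have hsites : sites n m = ↑(box \ centres) := by
    ext p
    rw [Finset.mem_coe, Finset.mem_sdiff, hcentres, mem_sites_iff]
    simp only [box, Finset.mem_product, Finset.mem_Ico]
    omega
  rw [hsites, Set.ncard_coe_finset, Finset.card_sdiff_of_subset fun p hp => (hcentres.1 hp).1,
    Finset.card_image_of_injective _ fun q r h => by grind]
  simp only [box, Finset.card_product, Int.card_Ico, sub_zero, Int.toNat_natCast]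
  lia

theorem finite_sites (n m : ℕ) : (sites n m).Finite :=
  (Set.finite_Icc ((0, 0) : ℤ × ℤ) (2 * n, 4 * m)).subset fun _ hp =>
    ⟨⟨hp.2.1.1, hp.2.2.1⟩, ⟨hp.2.1.2.le, hp.2.2.2.le⟩⟩

/-- The triangles that point down, as pairs `(i, j)`. If neither of the sides is glued, the triangle
`(-1, -1)` has no corner in the parallelogram. -/
noncomputable def downTriangles (u v : Bool) (n m : ℕ) : Finset (ℤ × ℤ) :=
  (Finset.Ico (if u then 0 else -1) (n : ℤ) ×ˢ
    Finset.Ico (if v then 0 else -1) (2 * (m : ℤ))).erase (-1, -1)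

theorem vertexSet_honeycomb (hn : 1 ≤ n) (hm : 1 ≤ m) : V(honeycomb u v n m) =
    ↑({0} ×ˢ (Finset.Ico 0 (n : ℤ) ×ˢ Finset.Ico 0 (2 * (m : ℤ))) ∪
      {1} ×ˢ downTriangles u v n m : Finset (ℤ × ℤ × ℤ)) := by
  ext ⟨s, i, j⟩
  simp only [downTriangles, Finset.mem_coe, Finset.mem_union, Finset.mem_product,
    Finset.mem_singleton, Finset.mem_erase, Finset.mem_Ico, Prod.mk.injEq, ne_eq]
  constructor
  · rintro ⟨p, hp, h⟩
    have hp := mem_sites_iff.1 hp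
    simp only [triangle, wrap, Prod.mk.injEq] at h
    cases u <;> cases v <;> grind
  · rintro (⟨rfl, hij⟩ | ⟨rfl, hij⟩)
    · exact ⟨(2 * i + 1, 2 * j + 1), mem_sites_iff.2 (by lia), .inl (by grind [triangle, wrap])⟩
    · refine ⟨(max 0 (2 * i + 1), max 0 (2 * j + 1)), mem_sites_iff.2 ?_, .inr ?_⟩
      · grind
      · grind [triangle, wrap]

theorem ncard_vertexSet_honeycomb (hn : 1 ≤ n) (hm : 1 ≤ m) : V(honeycomb u v n m).ncard =
    4 * (m * n) + (if v then 0 else n) + (if u then 0 else 2 * m) := by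
  have hrows : (2 * (m : ℤ)).toNat = 2 * m := by lia
  have hrows' : (2 * (m : ℤ) + 1).toNat = 2 * m + 1 := by lia
  rw [vertexSet_honeycomb hn hm, Set.ncard_coe_finset, Finset.card_union_of_disjoint
    (Finset.disjoint_product.2 (.inl (by simp)))]
  cases u <;> cases v <;>
    simp [downTriangles, Finset.card_erase_eq_ite, hrows, hrows'] <;> lia

end Honeycomb

section Kagome

/-- The sites of the parallelogram that remain when the vertices `u*` and `v*` are deleted unless
they are glued to the opposite side. -/
def keptSites (u v : Bool) (n m : ℕ) : Set (ℤ × ℤ) :=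
  {p ∈ patchSites n m | (p.1 = 2 * n → u) ∧ (p.2 = 4 * m → v)}

/-- The Kagomé lattice with the sides `u*` and `v*` glued to the sides `u` and `v` or deleted, as
told by the flags `u` and `v`: it comprises the three boundary conditions. -/
def kagome (u v : Bool) (n m : ℕ) : Graph (ℤ × ℤ) (Sym2 (ℤ × ℤ)) :=
  ((Graph.ofSimpleGraph triangularLattice).induce (keptSites u v n m)).map (glueV m ∘ glueU n)

/-- The triangle on one side of the site `p` in the plane, before the sides of the parallelogram are
glued; it is encoded as in `triangle`. -/
def planeTriangle (s : ℤ) (p : ℤ × ℤ) : ℤ × ℤ × ℤ := (s, (p.1 - s) / 2, (p.2 - s) / 2)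

/-- The triangle of which an edge of the Kagomé lattice is a side. The infimum of two corners of a
triangle has two odd coordinates exactly if the triangle points down. -/
def triangleOfEdge (e : Sym2 (ℤ × ℤ)) : ℤ × ℤ × ℤ :=
  if e.inf.1 % 2 = 1 ∧ e.inf.2 % 2 = 1 then planeTriangle 1 e.inf else planeTriangle 0 e.inf

variable {u v : Bool} {n m : ℕ} {p q x : ℤ × ℤ} {s : ℤ}

theorem mem_keptSites_iff : p ∈ keptSites u v n m ↔
    (p.1 % 2 = 1 ∨ p.2 % 2 = 1) ∧ (0 ≤ p.1 ∧ p.1 ≤ 2 * n ∧ (p.1 = 2 * n → u)) ∧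
      (0 ≤ p.2 ∧ p.2 ≤ 4 * m ∧ (p.2 = 4 * m → v)) := by
  simp only [keptSites, patchSites, Int.odd_iff, Set.mem_ofPred_eq]
  tauto

theorem odd_of_mem_keptSites (hp : p ∈ keptSites u v n m) : p.1 % 2 = 1 ∨ p.2 % 2 = 1 :=
  (mem_keptSites_iff.1 hp).1

theorem glueV_glueU (n m : ℕ) (p : ℤ × ℤ) : glueV m (glueU n p) =
    (if p.1 = 2 * n then 0 else p.1, if p.2 = 4 * m then 0 else p.2) := by
  grind [glueV, glueU]

theorem glue_mem_sites (hn : 1 ≤ n) (hm : 1 ≤ m) (hp : p ∈ keptSites u v n m) :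
    glueV m (glueU n p) ∈ sites n m := by
  rw [mem_keptSites_iff] at hp
  rw [mem_sites_iff, glueV_glueU]
  grind

theorem eq_of_glue_eq (hglue : glueV m (glueU n p) = glueV m (glueU n q))
    (htri : planeTriangle s p = planeTriangle s q) : p = q := by
  simp only [glueV_glueU, planeTriangle, Prod.mk.injEq] at hglue htri
  ext <;> grind

theorem exists_lift (hs : s = 0 ∨ s = 1) (hx : x ∈ sites n m) :
    ∃ p ∈ keptSites u v n m,
      glueV m (glueU n p) = x ∧ planeTriangle s p = triangle u v n m s x := by
  rw [mem_sites_iff] at hx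
  refine ⟨(if u ∧ s = 1 ∧ x.1 = 0 then 2 * n else x.1, if v ∧ s = 1 ∧ x.2 = 0 then 4 * m else x.2),
    ?_, ?_, ?_⟩
  · rw [mem_keptSites_iff]
    grind
  · rw [glueV_glueU]
    grind
  · simp only [planeTriangle, triangle, wrap]
    grind

theorem triangularLattice_adj_iff (hp : p.1 % 2 = 1 ∨ p.2 % 2 = 1)
    (hq : q.1 % 2 = 1 ∨ q.2 % 2 = 1) :
    triangularLattice.Adj p q ↔
      p ≠ q ∧ ∃ s, (s = 0 ∨ s = 1) ∧ planeTriangle s p = planeTriangle s q := by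
  rw [triangularLattice, SimpleGraph.fromRel_adj]
  simp only [or_and_right, exists_or, exists_eq_left, planeTriangle, Prod.ext_iff, Prod.fst_add,
    Prod.snd_add, ne_eq, true_and]
  omega

theorem triangleOfEdge_mk (hp : p.1 % 2 = 1 ∨ p.2 % 2 = 1) (hq : q.1 % 2 = 1 ∨ q.2 % 2 = 1)
    (hpq : p ≠ q) (hs : s = 0 ∨ s = 1) (htri : planeTriangle s p = planeTriangle s q) :
    triangleOfEdge s(p, q) = planeTriangle s p := by
  simp only [planeTriangle, true_and, ne_eq, Prod.ext_iff] at htri hpq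
  rw [triangleOfEdge, Sym2.inf_mk]
  obtain rfl | rfl := hs <;> split_ifs with hodd <;>
    simp only [planeTriangle, Prod.mk.injEq, Prod.fst_inf, Prod.snd_inf] at hodd ⊢ <;> lia

/-- A triangle with two corners in the parallelogram does not stick out of it. -/
theorem triangle_glue (hp : p ∈ keptSites u v n m) (hq : q ∈ keptSites u v n m) (hpq : p ≠ q)
    (hs : s = 0 ∨ s = 1) (htri : planeTriangle s p = planeTriangle s q) :
    triangle u v n m s (glueV m (glueU n p)) = planeTriangle s p := by
  rw [mem_keptSites_iff] at hp hq
  simp only [glueV_glueU, planeTriangle, triangle, wrap, Prod.mk.injEq] at *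
  obtain rfl | rfl := hs <;> grind

theorem kagome_isLink_iff {e : Sym2 (ℤ × ℤ)} {x y : ℤ × ℤ} : (kagome u v n m).IsLink e x y ↔
    ∃ p ∈ keptSites u v n m, ∃ q ∈ keptSites u v n m, e = s(p, q) ∧ p ≠ q ∧
      (∃ s, (s = 0 ∨ s = 1) ∧ planeTriangle s p = planeTriangle s q) ∧
      glueV m (glueU n p) = x ∧ glueV m (glueU n q) = y := by
  have hadj {p q : ℤ × ℤ} (hp : p ∈ keptSites u v n m) (hq : q ∈ keptSites u v n m) :=
    triangularLattice_adj_iff (odd_of_mem_keptSites hp) (odd_of_mem_keptSites hq)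
  constructor
  · rintro ⟨p, q, ⟨⟨rfl, h⟩, hp, hq⟩, rfl, rfl⟩
    obtain ⟨hpq, htri⟩ := (hadj hp hq).1 h
    exact ⟨p, hp, q, hq, rfl, hpq, htri, rfl, rfl⟩
  · rintro ⟨p, hp, q, hq, rfl, hpq, htri, rfl, rfl⟩
    exact ⟨p, q, ⟨⟨rfl, (hadj hp hq).2 ⟨hpq, htri⟩⟩, hp, hq⟩, rfl, rfl⟩

theorem vertexSet_kagome (hn : 1 ≤ n) (hm : 1 ≤ m) : V(kagome u v n m) = sites n m := by
  ext x
  rw [kagome, Graph.vertexSet_map]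
  constructor
  · rintro ⟨p, hp, rfl⟩
    exact glue_mem_sites hn hm hp
  · intro hx
    obtain ⟨p, hp, hpx, -⟩ := exists_lift (u := u) (v := v) (.inl rfl) hx
    exact ⟨p, hp, hpx⟩

theorem isLineGraphOf_kagome (hn : 1 ≤ n) (hm : 1 ≤ m) :
    IsLineGraphOf (kagome u v n m) (honeycomb u v n m) triangleOfEdge where
  vertexSet_eq := vertexSet_kagome hn hm
  ne_of_isLink {e x y} h := by
    obtain ⟨p, -, q, -, -, hpq, ⟨s, -, htri⟩, rfl, rfl⟩ := kagome_isLink_iff.1 h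
    exact fun hglue => hpq (eq_of_glue_eq hglue htri)
  inc_of_inc {e x} h := by
    obtain ⟨y, h⟩ := h
    obtain ⟨p, hp, q, hq, rfl, hpq, ⟨s, hs, htri⟩, rfl, rfl⟩ := kagome_isLink_iff.1 h
    rw [triangleOfEdge_mk (odd_of_mem_keptSites hp) (odd_of_mem_keptSites hq) hpq hs htri,
      honeycomb_inc_iff_fst]
    exact ⟨glue_mem_sites hn hm hp, hs, (triangle_glue hp hq hpq hs htri).symm⟩
  existsUnique_isLink {x y t} hx hy hxy := by
    obtain ⟨hx, ht, htx⟩ := honeycomb_inc_iff_fst.1 hx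
    obtain ⟨hy, -, hty⟩ := honeycomb_inc_iff_fst.1 hy
    obtain ⟨p, hp, rfl, hpt⟩ := exists_lift (u := u) (v := v) ht hx
    obtain ⟨q, hq, rfl, hqt⟩ := exists_lift (u := u) (v := v) ht hy
    have hpq : p ≠ q := fun h => hxy (by rw [h])
    have htri : planeTriangle t.1 p = planeTriangle t.1 q := by rw [hpt, hqt, ← htx, ← hty]
    have hlink : (kagome u v n m).IsLink s(p, q) (glueV m (glueU n p)) (glueV m (glueU n q)) :=
      kagome_isLink_iff.2 ⟨p, hp, q, hq, rfl, hpq, ⟨_, ht, htri⟩, rfl, rfl⟩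
    refine ⟨s(p, q), ⟨hlink, ?_⟩, ?_⟩
    · rw [triangleOfEdge_mk (odd_of_mem_keptSites hp) (odd_of_mem_keptSites hq) hpq ht htri, hpt,
        ← htx]
    · rintro e ⟨h, he⟩
      obtain ⟨p', hp', q', hq', rfl, hpq', ⟨s, hs, htri'⟩, hglue, hglue'⟩ := kagome_isLink_iff.1 h
      rw [triangleOfEdge_mk (odd_of_mem_keptSites hp') (odd_of_mem_keptSites hq') hpq' hs htri']
        at he
      obtain rfl : s = t.1 := congrArg Prod.fst he
      rw [eq_of_glue_eq hglue (he.trans (htx.trans hpt.symm)),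
        eq_of_glue_eq hglue' (htri'.symm.trans (he.trans (hty.trans hqt.symm)))]

end Kagome

section BoundaryConditions

variable {u v : Bool} {n m : ℕ} {p : ℤ × ℤ}

theorem mem_uStars_iff (hp : p ∈ patchSites n m) : p ∈ uStars n m ↔ p.1 = 2 * n := by
  simp only [patchSites, Set.mem_ofPred_eq, Int.odd_iff] at hp
  constructor
  · rintro ⟨i, -, -, rfl⟩
    rfl
  · exact fun h => ⟨((p.2 + 1) / 2).toNat, by lia, by lia, Prod.ext h (by grind)⟩

theorem mem_vStars_iff (hp : p ∈ patchSites n m) : p ∈ vStars n m ↔ p.2 = 4 * m := by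
  simp only [patchSites, Set.mem_ofPred_eq, Int.odd_iff] at hp
  constructor
  · rintro ⟨j, -, -, rfl⟩
    rfl
  · exact fun h => ⟨((p.1 + 1) / 2).toNat, by lia, by lia, Prod.ext (by grind) h⟩

theorem patch_deleteVerts (n m : ℕ) (X : Set (ℤ × ℤ)) : (patch n m).deleteVerts X =
    (Graph.ofSimpleGraph triangularLattice).induce (patchSites n m \ X) := by
  refine Graph.ext rfl fun e x y => ?_
  rw [patch, Graph.deleteVerts_isLink, Graph.induce_isLink, Graph.induce_isLink]
  grind

theorem kagomeTorus_eq : kagomeTorus = kagome true true := by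
  funext n m
  rw [kagomeTorus, Graph.map_map, kagome, patch]
  congr 2
  simp [keptSites]

theorem kagomeCylinder_eq : kagomeCylinder = kagome true false := by
  funext n m
  have hkept : patchSites n m \ vStars n m = keptSites true false n m := by
    ext p
    refine and_congr_right fun hp => ?_
    simp [mem_vStars_iff hp]
  rw [kagomeCylinder, patch_deleteVerts, hkept, kagome]
  refine Graph.map_eq_of_eqOn fun p hp => ?_
  have hp := mem_keptSites_iff.1 hp
  grind [glueU, glueV]

theorem kagomeFree_eq : kagomeFree = kagome false false := by
  funext n m
  have hkept : patchSites n m \ (uStars n m ∪ vStars n m) = keptSites false false n m := by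
    ext p
    refine and_congr_right fun hp => ?_
    simp [mem_uStars_iff hp, mem_vStars_iff hp]
  rw [kagomeFree, patch_deleteVerts, hkept, kagome]
  conv_lhs => rw [← Graph.map_id (G := Graph.induce _ _)]
  refine Graph.map_eq_of_eqOn fun p hp => ?_
  have hp := mem_keptSites_iff.1 hp
  grind [glueU, glueV]

theorem numPerfectMatchings_kagome (u v : Bool) (hn : 1 ≤ n) (hm : 1 ≤ m) :
    (numPerfectMatchings (kagome u v n m) : ℚ) =
      2 ^ (2 * (m : ℤ) * n - (if u then 0 else 2 * (m : ℤ)) - (if v then 0 else (n : ℤ)) + 1) := by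
  have hV : V(honeycomb u v n m).Finite := by
    rw [vertexSet_honeycomb hn hm]
    exact Finset.finite_toSet _
  have hsites : E(honeycomb u v n m).ncard = 6 * (m * n) := ncard_sites n m
  have heven : Even E(honeycomb u v n m).ncard := hsites ▸ ⟨3 * (m * n), by ring⟩
  have h := (isLineGraphOf_kagome hn hm).numPerfectMatchings_mul_two_pow (finite_sites n m) hV
    ncard_incidenceSet_honeycomb_le (isConnected_honeycomb hn hm) heven
  rw [hsites, ncard_vertexSet_honeycomb hn hm] at h
  replace h := congrArg (Nat.cast : ℕ → ℚ) h
  push_cast at h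
  rw [eq_div_of_mul_eq (by positivity) h, ← zpow_natCast, ← zpow_natCast, ← zpow_sub₀ two_ne_zero]
  push_cast
  ring_nf

end BoundaryConditions

section Entropy

theorem tendsto_two_mul_add_div (a b c : ℝ) :
    Tendsto (fun p : ℕ × ℕ => (2 * (p.2 : ℝ) * p.1 + a * p.2 + b * p.1 + c) / (3 * (p.2 * p.1)))
      (atTop ×ˢ atTop) (𝓝 (2 / 3)) := by
  have hn : Tendsto (fun p : ℕ × ℕ => (p.1 : ℝ)⁻¹) (atTop ×ˢ atTop) (𝓝 0) :=
    tendsto_inv_atTop_nhds_zero_nat.comp tendsto_fst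
  have hm : Tendsto (fun p : ℕ × ℕ => (p.2 : ℝ)⁻¹) (atTop ×ˢ atTop) (𝓝 0) :=
    tendsto_inv_atTop_nhds_zero_nat.comp tendsto_snd
  have h := (((hn.const_mul (a / 3)).const_add (2 / 3)).add (hm.const_mul (b / 3))).add
    ((hn.mul hm).const_mul (c / 3))
  simp only [mul_zero, add_zero] at h
  refine h.congr' ?_
  filter_upwards [tendsto_fst.eventually (eventually_ge_atTop 1),
    tendsto_snd.eventually (eventually_ge_atTop 1)] with p hp hq
  have hp : (p.1 : ℝ) ≠ 0 := by positivity
  have hq : (p.2 : ℝ) ≠ 0 := by positivity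
  field_simp

theorem hasEntropy_of_eq_zpow {α β : Type*} {G : ℕ → ℕ → Graph α β} (a b c : ℤ)
    (hM : ∀ n m : ℕ, 1 ≤ n → 1 ≤ m →
      (numPerfectMatchings (G n m) : ℚ) = 2 ^ (2 * (m : ℤ) * n + a * m + b * n + c))
    (hV : ∀ n m : ℕ, 1 ≤ n → 1 ≤ m → V(G n m).ncard = 6 * (m * n)) :
    HasEntropy G (2 / 3 * Real.log 2) := by
  refine ((tendsto_two_mul_add_div a b c).mul_const (Real.log 2)).congr' ?_
  filter_upwards [tendsto_fst.eventually (eventually_ge_atTop 1),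
    tendsto_snd.eventually (eventually_ge_atTop 1)] with p hp hq
  have h : (numPerfectMatchings (G p.1 p.2) : ℝ) =
      2 ^ (2 * (p.2 : ℤ) * p.1 + a * p.2 + b * p.1 + c) := by
    simpa using congrArg (Rat.cast : ℚ → ℝ) (hM p.1 p.2 hp hq)
  rw [h, hV p.1 p.2 hp hq, Real.log_zpow]
  have hp : (p.1 : ℝ) ≠ 0 := by positivity
  have hq : (p.2 : ℝ) ≠ 0 := by positivity
  push_cast
  field_simp
  ring

theorem hasEntropy_kagome (u v : Bool) : HasEntropy (kagome u v) (2 / 3 * Real.log 2) := by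
  refine hasEntropy_of_eq_zpow (if u then 0 else -2) (if v then 0 else -1) 1
    (fun n m hn hm => ?_) fun n m hn hm => ?_
  · rw [numPerfectMatchings_kagome u v hn hm]
    cases u <;> cases v <;> simp <;> ring_nf
  · rw [vertexSet_kagome hn hm, ncard_sites]

end Entropy

end KagomeDimers

theorem theorem3p4 :
    (∀ n m : ℕ, 1 ≤ n → 1 ≤ m →
      (KagomeDimers.numPerfectMatchings (KagomeDimers.kagomeTorus n m) : ℚ) =
          2 ^ (2 * (m : ℤ) * n + 1) ∧
      (KagomeDimers.numPerfectMatchings (KagomeDimers.kagomeCylinder n m) : ℚ) =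
          2 ^ (2 * (m : ℤ) * n - n + 1) ∧
      (KagomeDimers.numPerfectMatchings (KagomeDimers.kagomeFree n m) : ℚ) =
          2 ^ (2 * (m : ℤ) * n - 2 * m - n + 1)) ∧
    KagomeDimers.HasEntropy KagomeDimers.kagomeTorus (2 / 3 * Real.log 2) ∧
    KagomeDimers.HasEntropy KagomeDimers.kagomeCylinder (2 / 3 * Real.log 2) ∧
    KagomeDimers.HasEntropy KagomeDimers.kagomeFree (2 / 3 * Real.log 2) := by
  rw [KagomeDimers.kagomeTorus_eq, KagomeDimers.kagomeCylinder_eq, KagomeDimers.kagomeFree_eq]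
  refine ⟨fun n m hn hm => ⟨?_, ?_, ?_⟩, KagomeDimers.hasEntropy_kagome true true,
    KagomeDimers.hasEntropy_kagome true false, KagomeDimers.hasEntropy_kagome false false⟩
  · simpa using KagomeDimers.numPerfectMatchings_kagome true true hn hm
  · simpa using KagomeDimers.numPerfectMatchings_kagome true false hn hm
  · simpa using KagomeDimers.numPerfectMatchings_kagome false false hn hm
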